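/- Let $n,K\ge 1$, let $H\in\mathbb R^{n\times K}$ have full rank $K$, let $\gamma\in\mathbb R$, let $A\in\mathbb R^{n\times n}$ be symmetric positive semidefinite, and let $\hat H=H+E$, where $E$ is a random $n\times K$ matrix whose columns are independent and each distributed as $\mathcal N_n(0,\gamma^2A)$. For a matrix $M$ with $n$ rows, $P_{[M]}$ denotes the orthogonal projection of $\mathbb R^n$ onto the span of the columns of $M$; $|||\cdot|||$ is the operator norm for the Euclidean norm; $\rho(M)$ and $\rho_{\min}(M)$ are the largest and smallest eigenvalues of a symmetric matrix $M$, and $\mathrm{Cond}(M)=\rho(M)/\rho_{\min}(M)$. For every $\delta\in(0,1)$ there are constants $d_\delta>0$ and $D_\delta>0$, depending only on $\delta$ (not on $n,K,H,\gamma,A$ or the probability space), such that, whenever $$\tfrac14\,\rho_{\min}(H^TH)>d_\delta\, n\,\gamma^2\rho(A),$$ both of the following bounds hold simultaneously with probability at least $1-\delta$: $$\frac1n|||P_{[H]}-P_{[\hat H]}|||^2\le \gamma^2D_\delta\,\mathrm{Cond}(H^TH)^2\max\left(\frac{\max\big(K\rho(A),\mathrm{Tr}(A)\big)}{n\,\rho_{\min}(H^TH)},\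 \mathrm{Cond}(H^TH)\frac{\rho(A)}{n}\mathrm{Tr}\big((H^TH)^{-1}\big)\right)$$ and $$\frac1n|||P_{[\hat H]}-P_{[H]}|||^2\le \gamma^2D_\delta\,\mathrm{Cond}(H^TH)^3\max\left(\frac Kn\,\frac{\rho(A)}{\rho_{\min}(H^TH)},\ \frac{\mathrm{Tr}(A)}{n\,\rho_{\min}(H^TH)}\right).$$ -/

import Mathlib

open MeasureTheory ProbabilityTheory

noncomputable section

/-- The `j`-th column of a real matrix, as a vector of Euclidean space. -/
def eucCol {n K : ℕ} (M : Matrix (Fin n) (Fin K) ℝ) (j : Fin K) : EuclideanSpace ℝ (Fin n) :=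
  WithLp.toLp 2 (fun i => M i j)

/-- `[M]`: the subspace of `ℝⁿ` spanned by the columns of `M`. -/
def colSpan {n K : ℕ} (M : Matrix (Fin n) (Fin K) ℝ) : Submodule ℝ (EuclideanSpace ℝ (Fin n)) :=
  Submodule.span ℝ (Set.range (eucCol M))

/-- `P_[M]`: the orthogonal projection of `ℝⁿ` onto the span of the columns of `M`. -/
def colProj {n K : ℕ} (M : Matrix (Fin n) (Fin K) ℝ) :
    EuclideanSpace ℝ (Fin n) →L[ℝ] EuclideanSpace ℝ (Fin n) :=
  (colSpan M).starProjection

/-- `ρ(M)`: the largest eigenvalue of a symmetric real matrix. -/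
def rhoMax {m : ℕ} (M : Matrix (Fin m) (Fin m) ℝ) : ℝ := sSup (spectrum ℝ M)

/-- `ρ_min(M)`: the smallest eigenvalue of a symmetric real matrix. -/
def rhoMin {m : ℕ} (M : Matrix (Fin m) (Fin m) ℝ) : ℝ := sInf (spectrum ℝ M)

/-- `Cond(M) = ρ(M) / ρ_min(M)`: the condition number of a positive definite matrix. -/
def condNumber {m : ℕ} (M : Matrix (Fin m) (Fin m) ℝ) : ℝ := rhoMax M / rhoMin M

/-- The columns of the random matrix `E` are independent with common law `N(0, γ² A)`. -/
structure GaussianIIDColumns {Ω : Type*} [MeasurableSpace Ω] (P : Measure Ω) {n K : ℕ}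
    (E : Ω → Matrix (Fin n) (Fin K) ℝ) (γ : ℝ) (A : Matrix (Fin n) (Fin n) ℝ) : Prop where
  law : ∀ j : Fin K, HasLaw (fun ω => eucCol (E ω) j) (multivariateGaussian 0 (γ ^ 2 • A)) P
  indep : iIndepFun (fun (j : Fin K) ω => eucCol (E ω) j) P

end

/-! Both bounds follow from a deterministic perturbation estimate and a bound on the operator norm
of `E`. Deterministic: if `H` has singular values at least `σ` and `E` has norm at most `B`, the
projections differ by at most `4 * (B / σ)` (`norm_colProj_sub_le`). For small `B` the column spaces
are close in both directions; for large `B` the bound exceeds 2 and is trivial. Random: for fixed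
`v`, `E v` is Gaussian with covariance `‖v‖² γ² A`, so a Chernoff bound controls its norm
(`measure_norm_sq_gt_le`). A union bound over a net of at most `5 ^ K` vectors gives `‖E‖² ≤ C γ²
max (K ρ(A)) (Tr A)` outside an event of probability at most `δ`. Taking `σ² = ρ_min(HᵀH)` and
squaring yields a bound without condition numbers; since `Cond ≥ 1`, it implies both claims. -/

/-! ### Perturbation of orthogonal projections -/

/-- Two orthogonal projections are close as soon as each range is close to the other. -/
theorem norm_starProjection_sub_le {F : Type*} [NormedAddCommGroup F] [InnerProductSpace ℝ F]
    (U V : Submodule ℝ F) [U.HasOrthogonalProjection] [V.HasOrthogonalProjection] {c : ℝ}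
    (hc : 0 ≤ c) (hU : ∀ x ∈ U, ∃ y ∈ V, ‖x - y‖ ≤ c * ‖x‖)
    (hV : ∀ x ∈ V, ∃ y ∈ U, ‖x - y‖ ≤ c * ‖x‖) :
    ‖U.starProjection - V.starProjection‖ ≤ 2 * c := by
  have key : ∀ (S T : Submodule ℝ F) [S.HasOrthogonalProjection] [T.HasOrthogonalProjection],
      (∀ x ∈ S, ∃ y ∈ T, ‖x - y‖ ≤ c * ‖x‖) →
      ∀ x ∈ S, ‖x - T.starProjection x‖ ≤ c * ‖x‖ := by
    intro S T _ _ h x hx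
    obtain ⟨y, hy, hxy⟩ := h x hx
    refine le_trans ?_ hxy
    rw [Submodule.starProjection_minimal]
    exact ciInf_le ⟨0, by rintro _ ⟨w, rfl⟩; positivity⟩ (⟨y, hy⟩ : T)
  have hU' := key U V hU
  have hV' := key V U hV
  refine ContinuousLinearMap.opNorm_le_bound _ (by positivity) fun x => ?_
  set q := V.starProjection x with hq
  have hq_mem : q ∈ V := V.starProjection_apply_mem x
  set y := U.starProjection (x - q) with hy
  have hy_mem : y ∈ U := U.starProjection_apply_mem _
  -- With `q` the projection of `x` to `V`, the difference splits into the `U`-part of `x - q` and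
  -- the defect of `q` from `U`; each is at most `c * ‖x‖`.
  have hsub : (U.starProjection - V.starProjection) x = y - (q - U.starProjection q) := by
    simp [hy, ← hq]
  have h1 : ‖q - U.starProjection q‖ ≤ c * ‖x‖ :=
    (hV' q hq_mem).trans (by gcongr; exact V.norm_starProjection_apply_le x)
  have horth : ∀ z ∈ V, inner ℝ (x - q) z = 0 := fun z hz =>
    V.starProjection_inner_eq_zero x z hz
  have h2 : ‖y‖ ≤ c * ‖x‖ := by
    have e1 : inner ℝ (x - q) y = ‖y‖ ^ 2 := by
      have := U.starProjection_inner_eq_zero (x - q) y hy_mem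
      rw [← hy, inner_sub_left, real_inner_self_eq_norm_sq] at this
      linarith
    -- As `x - q` is orthogonal to `V`, only the part of `y` outside `V` contributes, and that part
    -- is small because `y ∈ U`.
    have e2 : inner ℝ (x - q) (y - V.starProjection y) = ‖y‖ ^ 2 := by
      rw [inner_sub_right, horth _ (V.starProjection_apply_mem y), e1, sub_zero]
    have e3 : ‖x - q‖ ≤ ‖x‖ := by
      have := V.norm_sq_eq_add_norm_sq_starProjection x
      rw [Submodule.starProjection_orthogonal_val] at this
      rw [← hq] at this
      exact abs_le_of_sq_le_sq' (by nlinarith [sq_nonneg ‖q‖]) (norm_nonneg _) |>.2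
    have e4 : ‖y‖ ^ 2 ≤ ‖x‖ * (c * ‖y‖) := by
      rw [← e2]
      exact (real_inner_le_norm _ _).trans
        (mul_le_mul e3 (hU' y hy_mem) (norm_nonneg _) (norm_nonneg _))
    rcases (norm_nonneg y).eq_or_lt with h | h
    · rw [← h]; positivity
    · nlinarith
  rw [hsub]
  calc ‖y - (q - U.starProjection q)‖ ≤ ‖y‖ + ‖q - U.starProjection q‖ := norm_sub_le _ _
    _ ≤ 2 * c * ‖x‖ := by linarith

theorem toEuclideanLin_apply_eq_sum {n K : ℕ} (M : Matrix (Fin n) (Fin K) ℝ)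
    (v : EuclideanSpace ℝ (Fin K)) :
    Matrix.toEuclideanLin M v = ∑ j, v j • eucCol M j := by
  ext i
  simp [Matrix.toLpLin_apply, Matrix.mulVec, dotProduct, eucCol, mul_comm]

theorem mem_colSpan_iff {n K : ℕ} (M : Matrix (Fin n) (Fin K) ℝ) (x : EuclideanSpace ℝ (Fin n)) :
    x ∈ colSpan M ↔ ∃ v, Matrix.toEuclideanLin M v = x := by
  rw [colSpan, Submodule.mem_span_range_iff_exists_fun]
  constructor
  · rintro ⟨c, hc⟩
    exact ⟨WithLp.toLp 2 c, by rw [toEuclideanLin_apply_eq_sum, ← hc]⟩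
  · rintro ⟨v, hv⟩
    exact ⟨fun j => v j, by rw [← hv, toEuclideanLin_apply_eq_sum]⟩

/-- Perturbation of column spaces: `σ` is a lower bound for the singular values of `H` and `B` an
upper bound for those of `E`. -/
theorem norm_colProj_sub_le {n K : ℕ} (H E : Matrix (Fin n) (Fin K) ℝ) {σ B : ℝ} (hσ : 0 < σ)
    (hB : 0 ≤ B) (hH : ∀ v, σ * ‖v‖ ≤ ‖Matrix.toEuclideanLin H v‖)
    (hE : ∀ v, ‖Matrix.toEuclideanLin E v‖ ≤ B * ‖v‖) :
    ‖colProj H - colProj (H + E)‖ ≤ 4 * (B / σ) := by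
  -- If `B ≤ σ / 2`, the singular values of `H + E` stay above `σ / 2`, so `c = 2 * (B / σ)` serves
  -- both directions.
  rcases le_total B (σ / 2) with hBσ | hBσ
  · have hc : 0 ≤ 2 * (B / σ) := by positivity
    have := norm_starProjection_sub_le (colSpan H) (colSpan (H + E)) hc ?_ ?_
    · rw [colProj, colProj]; linarith
    · intro x hx
      obtain ⟨v, rfl⟩ := (mem_colSpan_iff _ _).1 hx
      refine ⟨_, (mem_colSpan_iff _ _).2 ⟨v, rfl⟩, ?_⟩
      rw [map_add, LinearMap.add_apply, sub_add_cancel_left, norm_neg]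
      calc _ ≤ B * ‖v‖ := hE v
        _ = (B / σ) * (σ * ‖v‖) := by field_simp
        _ ≤ (B / σ) * ‖Matrix.toEuclideanLin H v‖ := by gcongr; exact hH v
        _ ≤ _ := by gcongr; linarith [div_nonneg hB hσ.le]
    · intro x hx
      obtain ⟨v, rfl⟩ := (mem_colSpan_iff _ _).1 hx
      refine ⟨_, (mem_colSpan_iff _ _).2 ⟨v, rfl⟩, ?_⟩
      have hlow : σ / 2 * ‖v‖ ≤ ‖Matrix.toEuclideanLin (H + E) v‖ := by
        rw [map_add, LinearMap.add_apply]
        have h1 := norm_sub_le_norm_add (Matrix.toEuclideanLin H v) (Matrix.toEuclideanLin E v)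
        have h2 := mul_le_mul_of_nonneg_right hBσ (norm_nonneg v)
        linarith [hH v, hE v]
      calc _ = ‖Matrix.toEuclideanLin E v‖ := by
            rw [map_add, LinearMap.add_apply, add_sub_cancel_left]
        _ ≤ B * ‖v‖ := hE v
        _ = 2 * (B / σ) * (σ / 2 * ‖v‖) := by field_simp
        _ ≤ _ := by gcongr
  · have h1 : 1 / 2 ≤ B / σ := by rw [le_div_iff₀ hσ]; linarith
    calc _ ≤ ‖colProj H‖ + ‖colProj (H + E)‖ := norm_sub_le _ _
      _ ≤ 1 + 1 := add_le_add (Submodule.starProjection_norm_le _)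
          (Submodule.starProjection_norm_le _)
      _ ≤ _ := by linarith

/-! ### Quadratic forms and extreme eigenvalues -/

theorem inner_toEuclideanLin_self_eq_sum {m : ℕ} {M : Matrix (Fin m) (Fin m) ℝ}
    (hM : M.IsHermitian) (v : EuclideanSpace ℝ (Fin m)) :
    inner ℝ v (Matrix.toEuclideanLin M v) =
      ∑ i, hM.eigenvalues i * inner ℝ (hM.eigenvectorBasis i) v ^ 2 := by
  have h (i : Fin m) : inner ℝ (hM.eigenvectorBasis i) (Matrix.toEuclideanLin M v) =
      hM.eigenvalues i * inner ℝ (hM.eigenvectorBasis i) v := by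
    have hs := (Matrix.isSymmetric_toEuclideanLin_iff.2 hM) (hM.eigenvectorBasis i) v
    rw [← hs, Matrix.toLpLin_apply, hM.mulVec_eigenvectorBasis, WithLp.toLp_smul,
      WithLp.toLp_ofLp, real_inner_smul_left]
  rw [← hM.eigenvectorBasis.sum_inner_mul_inner]
  refine Finset.sum_congr rfl fun i _ => ?_
  rw [h, real_inner_comm]; ring

theorem norm_toEuclideanLin_sq {n K : ℕ} (H : Matrix (Fin n) (Fin K) ℝ)
    (v : EuclideanSpace ℝ (Fin K)) :
    ‖Matrix.toEuclideanLin H v‖ ^ 2 =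
      inner ℝ v (Matrix.toEuclideanLin (H.transpose * H) v) := by
  rw [← Matrix.conjTranspose_eq_transpose_of_trivial, Matrix.toLpLin_mul (q := 2),
    LinearMap.comp_apply, Matrix.toEuclideanLin_conjTranspose_eq_adjoint,
    LinearMap.adjoint_inner_right, real_inner_self_eq_norm_sq]

theorem rhoMin_le_eigenvalues {m : ℕ} {M : Matrix (Fin m) (Fin m) ℝ} (hM : M.IsHermitian)
    (i : Fin m) : rhoMin M ≤ hM.eigenvalues i :=
  csInf_le Matrix.finite_real_spectrum.bddBelow (hM.eigenvalues_mem_spectrum_real i)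

theorem eigenvalues_le_rhoMax {m : ℕ} {M : Matrix (Fin m) (Fin m) ℝ} (hM : M.IsHermitian)
    (i : Fin m) : hM.eigenvalues i ≤ rhoMax M :=
  le_csSup Matrix.finite_real_spectrum.bddAbove (hM.eigenvalues_mem_spectrum_real i)

theorem rhoMin_mul_norm_sq_le {n K : ℕ} (H : Matrix (Fin n) (Fin K) ℝ)
    (v : EuclideanSpace ℝ (Fin K)) :
    rhoMin (H.transpose * H) * ‖v‖ ^ 2 ≤ ‖Matrix.toEuclideanLin H v‖ ^ 2 := by
  have hM : (H.transpose * H).IsHermitian := by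
    simpa using Matrix.isHermitian_conjTranspose_mul_self H
  rw [norm_toEuclideanLin_sq, inner_toEuclideanLin_self_eq_sum hM,
    ← hM.eigenvectorBasis.sum_sq_inner_right, Finset.mul_sum]
  exact Finset.sum_le_sum fun i _ =>
    mul_le_mul_of_nonneg_right (rhoMin_le_eigenvalues hM i) (sq_nonneg _)

theorem rhoMin_transpose_mul_self_pos {n K : ℕ} (hK : 1 ≤ K) {H : Matrix (Fin n) (Fin K) ℝ}
    (hH : H.rank = K) : 0 < rhoMin (H.transpose * H) := by
  have hM : (H.transpose * H).IsHermitian := by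
    simpa using Matrix.isHermitian_conjTranspose_mul_self H
  have hpd : (H.transpose * H).PosDef := by
    rw [← Matrix.conjTranspose_eq_transpose_of_trivial]
    refine Matrix.PosDef.conjTranspose_mul_self H ?_
    have hker := H.mulVecLin.finrank_range_add_finrank_ker
    rw [← Matrix.rank, hH, Module.finrank_fin_fun, Nat.add_eq_left,
      Submodule.finrank_eq_zero] at hker
    exact LinearMap.ker_eq_bot.1 hker
  -- `K ≥ 1` makes the spectrum nonempty, so its infimum is an eigenvalue and not the default `sInf
  -- ∅ = 0`.
  have : Nonempty (Fin K) := ⟨⟨0, hK⟩⟩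
  obtain ⟨i, hi⟩ : rhoMin (H.transpose * H) ∈ Set.range hM.eigenvalues := by
    rw [← hM.spectrum_real_eq_range_eigenvalues]
    exact (hM.spectrum_real_eq_range_eigenvalues ▸ Set.range_nonempty _ :
      (spectrum ℝ (H.transpose * H)).Nonempty).csInf_mem Matrix.finite_real_spectrum
  rw [← hi]
  exact hpd.eigenvalues_pos i

theorem rhoMin_le_rhoMax {m : ℕ} (hm : 1 ≤ m) {M : Matrix (Fin m) (Fin m) ℝ}
    (hM : M.IsHermitian) : rhoMin M ≤ rhoMax M :=
  (rhoMin_le_eigenvalues hM ⟨0, hm⟩).trans (eigenvalues_le_rhoMax hM ⟨0, hm⟩)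

theorem rhoMax_nonneg {m : ℕ} {M : Matrix (Fin m) (Fin m) ℝ} (hM : M.PosSemidef) :
    0 ≤ rhoMax M := by
  refine Real.sSup_nonneg fun x hx => ?_
  rw [hM.1.spectrum_real_eq_range_eigenvalues] at hx
  obtain ⟨i, rfl⟩ := hx
  exact hM.eigenvalues_nonneg i

/-! ### Gaussian exponential moments and tails -/

/-- The exact value is `(1 - 2a)^(-1/2)`, and `(1 - 2a) e^(4a) ≥ (1 - 2a)(1 + 4a) ≥ 1` for `0 ≤ a ≤
1/4`. -/
theorem lintegral_exp_mul_sq_gaussianReal_le {a : ℝ} (ha0 : 0 ≤ a) (ha : a ≤ 1 / 4) :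
    ∫⁻ x, ENNReal.ofReal (Real.exp (a * x ^ 2)) ∂(gaussianReal 0 1)
      ≤ ENNReal.ofReal (Real.exp (2 * a)) := by
  have hb : 0 < 1 / 2 - a := by linarith
  rw [gaussianReal_of_var_ne_zero 0 one_ne_zero,
    lintegral_withDensity_eq_lintegral_mul _ (measurable_gaussianPDF 0 1) (by fun_prop)]
  have hpt (x : ℝ) : (gaussianPDF 0 1 * fun x => ENNReal.ofReal (Real.exp (a * x ^ 2))) x =
      ENNReal.ofReal ((√(2 * Real.pi))⁻¹ * Real.exp (-(1 / 2 - a) * x ^ 2)) := by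
    rw [Pi.mul_apply, gaussianPDF_def, ← ENNReal.ofReal_mul (gaussianPDFReal_nonneg 0 1 x),
      gaussianPDFReal_def]
    congr 1
    simp only [NNReal.coe_one, mul_one, sub_zero]
    rw [mul_assoc, ← Real.exp_add]
    congr 2
    ring
  simp_rw [hpt]
  rw [← ofReal_integral_eq_lintegral_ofReal ((integrable_exp_neg_mul_sq hb).const_mul _)
    (Filter.Eventually.of_forall fun x => by positivity), integral_const_mul, integral_gaussian]
  refine ENNReal.ofReal_le_ofReal ?_
  rw [← Real.sqrt_inv, ← Real.sqrt_mul (by positivity)]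
  refine Real.sqrt_le_iff.2 ⟨(Real.exp_pos _).le, ?_⟩
  have h1 : (2 * Real.pi)⁻¹ * (Real.pi / (1 / 2 - a)) = 1 / (1 - 2 * a) := by
    have : 1 - 2 * a ≠ 0 := by linarith
    have := Real.pi_ne_zero
    field_simp
  have h2 : Real.exp (2 * a) ^ 2 = Real.exp (4 * a) := by
    rw [← Real.exp_nat_mul]; congr 1; push_cast; ring
  rw [h1, h2, div_le_iff₀ (by linarith)]
  nlinarith [Real.add_one_le_exp (4 * a)]

open scoped MatrixOrder in
theorem norm_sqrt_apply_sq {m : ℕ} {S : Matrix (Fin m) (Fin m) ℝ} (hS : S.PosSemidef)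
    (v : EuclideanSpace ℝ (Fin m)) :
    ‖Matrix.toEuclideanCLM (𝕜 := ℝ) (CFC.sqrt S) v‖ ^ 2 =
      ∑ i, hS.1.eigenvalues i * inner ℝ (hS.1.eigenvectorBasis i) v ^ 2 := by
  have hT : (CFC.sqrt S).transpose = CFC.sqrt S := by
    have := (CFC.sqrt_nonneg S).isSelfAdjoint
    simpa [Matrix.star_eq_conjTranspose] using this.star_eq
  have hSS : CFC.sqrt S * CFC.sqrt S = S := CFC.sqrt_mul_sqrt_self S hS.nonneg
  have h := norm_toEuclideanLin_sq (CFC.sqrt S) v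
  rw [hT, hSS, inner_toEuclideanLin_self_eq_sum hS.1] at h
  rw [← h]
  rfl

-- In an eigenbasis of `S` the squared norm is a sum of independent weighted squares of standard
-- Gaussians; the integral factorizes and the exponents add up to the trace.
open scoped MatrixOrder in
theorem lintegral_exp_norm_sq_multivariateGaussian_le {m : ℕ} {S : Matrix (Fin m) (Fin m) ℝ}
    (hS : S.PosSemidef) {s : ℝ} (hs0 : 0 ≤ s) (hs : ∀ i, s * hS.1.eigenvalues i ≤ 1 / 4) :
    ∫⁻ x, ENNReal.ofReal (Real.exp (s * ‖x‖ ^ 2)) ∂(multivariateGaussian 0 S)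
      ≤ ENNReal.ofReal (Real.exp (2 * s * S.trace)) := by
  rw [multivariateGaussian, lintegral_map (by fun_prop) (by fun_prop),
    stdGaussian_eq_map_pi_orthonormalBasis hS.1.eigenvectorBasis,
    lintegral_map (by fun_prop) (by fun_prop)]
  have hpt (y : Fin m → ℝ) : ENNReal.ofReal (Real.exp (s * ‖(0 : EuclideanSpace ℝ (Fin m)) +
      Matrix.toEuclideanCLM (𝕜 := ℝ) (CFC.sqrt S)
        (∑ i, y i • hS.1.eigenvectorBasis i)‖ ^ 2)) =
      ∏ i, ENNReal.ofReal (Real.exp (s * hS.1.eigenvalues i * y i ^ 2)) := by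
    rw [zero_add, norm_sqrt_apply_sq hS, ← ENNReal.ofReal_prod_of_nonneg
      (fun i _ => (Real.exp_pos _).le), ← Real.exp_sum, Finset.mul_sum]
    congr 2
    refine Finset.sum_congr rfl fun i _ => ?_
    rw [hS.1.eigenvectorBasis.orthonormal.inner_right_fintype, mul_assoc]
  simp_rw [hpt]
  rw [lintegral_prod_eq_prod_lintegral_of_indepFun Finset.univ
    (fun i (y : Fin m → ℝ) => ENNReal.ofReal (Real.exp (s * hS.1.eigenvalues i * y i ^ 2)))
    (iIndepFun_pi (X := fun i (t : ℝ) =>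
      ENNReal.ofReal (Real.exp (s * hS.1.eigenvalues i * t ^ 2))) (fun i => by fun_prop))
    (fun i => by fun_prop)]
  have hi (i : Fin m) : ∫⁻ y : Fin m → ℝ,
      ENNReal.ofReal (Real.exp (s * hS.1.eigenvalues i * y i ^ 2))
        ∂(Measure.pi fun _ => gaussianReal 0 1) ≤
      ENNReal.ofReal (Real.exp (2 * (s * hS.1.eigenvalues i))) := by
    rw [(measurePreserving_eval (fun _ : Fin m => gaussianReal 0 1) i).lintegral_comp
      (f := fun t => ENNReal.ofReal (Real.exp (s * hS.1.eigenvalues i * t ^ 2))) (by fun_prop)]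
    exact lintegral_exp_mul_sq_gaussianReal_le (mul_nonneg hs0 (hS.eigenvalues_nonneg i)) (hs i)
  refine (Finset.prod_le_prod' fun i _ => hi i).trans_eq ?_
  rw [← ENNReal.ofReal_prod_of_nonneg (fun i _ => (Real.exp_pos _).le), ← Real.exp_sum,
    hS.1.trace_eq_sum_eigenvalues, Finset.mul_sum]
  congr 2
  refine Finset.sum_congr rfl fun i _ => ?_
  simp only [RCLike.ofReal_real_eq_id, id]
  ring

theorem eigenvalues_le_of_inner_le {m : ℕ} {S : Matrix (Fin m) (Fin m) ℝ} (hS : S.IsHermitian)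
    {r : ℝ} (hr : ∀ v, inner ℝ v (Matrix.toEuclideanLin S v) ≤ r * ‖v‖ ^ 2) (i : Fin m) :
    hS.eigenvalues i ≤ r := by
  have h := hr (hS.eigenvectorBasis i)
  rw [inner_toEuclideanLin_self_eq_sum hS, hS.eigenvectorBasis.orthonormal.1 i,
    Finset.sum_eq_single i] at h
  · simpa [hS.eigenvectorBasis.orthonormal.1 i] using h
  · intro j _ hj
    simp [hS.eigenvectorBasis.orthonormal.2 hj]
  · simp

/-- Chi-square type tail bound for the squared norm of a centered Gaussian vector. -/
theorem measure_norm_sq_gt_le {Ω : Type*} [MeasurableSpace Ω] {P : Measure Ω}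
    {m : ℕ} {S : Matrix (Fin m) (Fin m) ℝ} (hS : S.PosSemidef)
    {X : Ω → EuclideanSpace ℝ (Fin m)} (hX : HasLaw X (multivariateGaussian 0 S) P) {r : ℝ}
    (hr0 : 0 ≤ r) (hr : ∀ v, inner ℝ v (Matrix.toEuclideanLin S v) ≤ r * ‖v‖ ^ 2) (u : ℝ) :
    P {ω | 2 * S.trace + 4 * r * u < ‖X ω‖ ^ 2} ≤ ENNReal.ofReal (Real.exp (-u)) := by
  have hle := eigenvalues_le_of_inner_le hS.1 hr
  rcases hr0.eq_or_lt with rfl | hr0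
  -- For `r = 0` no useful `s = 1 / (4 * r)` exists, but the law is then a Dirac mass at 0.
  · have hS0 : S = 0 := by
      rw [← hS.1.eigenvalues_eq_zero_iff]
      exact funext fun i => le_antisymm (hle i) (hS.eigenvalues_nonneg i)
    subst hS0
    have hd : multivariateGaussian (0 : EuclideanSpace ℝ (Fin m)) 0 = Measure.dirac 0 := by
      simp [multivariateGaussian]
    rw [hd] at hX
    have hae := hX.ae_eq_of_dirac
    have : P {ω | 2 * (0 : Matrix (Fin m) (Fin m) ℝ).trace + 4 * 0 * u < ‖X ω‖ ^ 2} = 0 := by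
      have h0 : ∀ᵐ ω ∂P, ¬ (2 * (0 : Matrix (Fin m) (Fin m) ℝ).trace + 4 * 0 * u < ‖X ω‖ ^ 2) := by
        filter_upwards [hae] with ω hω
        simp [hω]
      simpa only [ae_iff, not_not] using h0
    rw [this]
    exact zero_le
  -- The largest `s` allowed by `s * r ≤ 1 / 4`; Markov's exponent `2 s Tr S - s t` then equals
  -- `-u`.
  · set s := 1 / (4 * r) with hs
    have hs0 : 0 < s := by positivity
    have hmom := lintegral_exp_norm_sq_multivariateGaussian_le hS hs0.le (fun i => by
      calc s * hS.1.eigenvalues i ≤ s * r := by gcongr; exact hle i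
        _ ≤ 1 / 4 := by rw [hs]; field_simp; rfl)
    rw [← hX.lintegral_comp (by fun_prop)] at hmom
    set t := 2 * S.trace + 4 * r * u
    have hmarkov := mul_meas_ge_le_lintegral₀ (μ := P)
      (f := fun ω => ENNReal.ofReal (Real.exp (s * ‖X ω‖ ^ 2)))
      (by have := hX.aemeasurable; fun_prop) (ENNReal.ofReal (Real.exp (s * t)))
    have hpos : 0 < Real.exp (s * t) := Real.exp_pos _
    calc P {ω | t < ‖X ω‖ ^ 2}
        ≤ P {ω | ENNReal.ofReal (Real.exp (s * t)) ≤
            ENNReal.ofReal (Real.exp (s * ‖X ω‖ ^ 2))} := by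
          refine measure_mono fun ω (hω : t < _) => ?_
          exact ENNReal.ofReal_le_ofReal (Real.exp_le_exp.2 (by gcongr))
      _ ≤ ENNReal.ofReal (Real.exp (2 * s * S.trace)) / ENNReal.ofReal (Real.exp (s * t)) := by
          rw [ENNReal.le_div_iff_mul_le (by simp [hpos]) (by simp), mul_comm]
          exact hmarkov.trans hmom
      _ = ENNReal.ofReal (Real.exp (-u)) := by
          rw [← ENNReal.ofReal_div_of_pos hpos, ← Real.exp_sub]
          congr 2
          simp only [t, hs]
          field_simp
          ring

/-- By independence the characteristic functions of the summands `v j • eucCol (E ω) j` multiply,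
and the weights `(v j)²` sum to `‖v‖²`. -/
theorem GaussianIIDColumns.hasLaw_toEuclideanLin {Ω : Type*} [MeasurableSpace Ω] {P : Measure Ω}
    [IsProbabilityMeasure P] {n K : ℕ} {E : Ω → Matrix (Fin n) (Fin K) ℝ} {γ : ℝ}
    {A : Matrix (Fin n) (Fin n) ℝ} (hA : A.PosSemidef) (hE : GaussianIIDColumns P E γ A)
    (v : EuclideanSpace ℝ (Fin K)) :
    HasLaw (fun ω => Matrix.toEuclideanLin (E ω) v)
      (multivariateGaussian 0 (‖v‖ ^ 2 • γ ^ 2 • A)) P := by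
  simp_rw [toEuclideanLin_apply_eq_sum]
  have hm (j : Fin K) : AEMeasurable (fun ω => eucCol (E ω) j) P := (hE.law j).aemeasurable
  have hmv (j : Fin K) : AEMeasurable (fun ω => v j • eucCol (E ω) j) P :=
    (hm j).const_smul (v j)
  refine ⟨Finset.aemeasurable_fun_sum _ fun j _ => hmv j, ?_⟩
  have hγA : (γ ^ 2 • A).PosSemidef := hA.smul (sq_nonneg γ)
  have hind : iIndepFun (fun j ω => v j • eucCol (E ω) j) P :=
    hE.indep.comp (fun j x => v j • x) (fun j => by fun_prop)
  have : IsProbabilityMeasure (P.map fun ω => ∑ j, v j • eucCol (E ω) j) :=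
    Measure.isProbabilityMeasure_map (Finset.aemeasurable_fun_sum _ fun j _ => hmv j)
  refine Measure.ext_of_charFun ?_
  rw [hind.charFun_map_fun_sum_eq_prod hmv]
  ext t
  rw [charFun_multivariateGaussian (hγA.smul (sq_nonneg _)), Finset.prod_apply]
  have hj (j : Fin K) : charFun (P.map fun ω => v j • eucCol (E ω) j) t =
      Complex.exp (-((v j : ℂ) ^ 2 * ((t.ofLp ⬝ᵥ (γ ^ 2 • A).mulVec t.ofLp : ℝ) : ℂ) / 2)) := by
    rw [charFun_map_smul_comp (hm j), (hE.law j).map_eq, charFun_multivariateGaussian hγA]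
    congr 1
    simp [Matrix.mulVec_smul, smul_dotProduct, dotProduct_smul]
    ring
  simp_rw [hj]
  rw [← Complex.exp_sum, EuclideanSpace.real_norm_sq_eq]
  congr 1
  simp [Matrix.smul_mulVec, dotProduct_smul, Finset.sum_mul, Finset.sum_div]

/-! ### Nets and the operator norm of a Gaussian matrix -/

/-- A `1`-net of the ball of radius `2`, of cardinality at most `5 ^ dim`. -/
theorem exists_finset_net (F : Type*) [NormedAddCommGroup F] [NormedSpace ℝ F]
    [FiniteDimensional ℝ F] :
    ∃ s : Finset F, s.card ≤ 5 ^ Module.finrank ℝ F ∧ (∀ c ∈ s, ‖c‖ ≤ 2) ∧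
      ∀ x : F, ‖x‖ ≤ 2 → ∃ c ∈ s, ‖x - c‖ ≤ 1 := by
  classical
  let p : ℕ → Prop := fun m => ∃ s : Finset F, s.card = m ∧ (∀ c ∈ s, ‖c‖ ≤ 2) ∧
    ∀ c ∈ s, ∀ d ∈ s, c ≠ d → 1 ≤ ‖c - d‖
  obtain ⟨s, hcard, hs2, hsep⟩ : p (Nat.findGreatest p (5 ^ Module.finrank ℝ F)) :=
    Nat.findGreatest_spec (m := 0) (Nat.zero_le _) ⟨∅, by simp⟩
  refine ⟨s, Besicovitch.card_le_of_separated s hs2 hsep, hs2, fun x hx => ?_⟩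
  -- A point far from `s` could be added to it, contradicting the maximal cardinality among
  -- separated sets.
  by_contra! hfar
  have hxs : x ∉ s := fun h => by simpa using (hfar x h).trans_le (by simp : ‖x - x‖ ≤ 1)
  have h2 : ∀ c ∈ insert x s, ‖c‖ ≤ 2 := by
    simpa [hx] using hs2
  have hsep' : ∀ c ∈ insert x s, ∀ d ∈ insert x s, c ≠ d → 1 ≤ ‖c - d‖ := by
    intro c hc d hd hcd
    rcases Finset.mem_insert.1 hc with hc | hc <;>
      rcases Finset.mem_insert.1 hd with hd | hd
    · exact absurd (hc.trans hd.symm) hcd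
    · exact hc ▸ (hfar d hd).le
    · rw [hd, norm_sub_rev]; exact (hfar c hc).le
    · exact hsep c hc d hd hcd
  have hle := Nat.le_findGreatest (P := p) (Besicovitch.card_le_of_separated _ h2 hsep')
    ⟨_, rfl, h2, hsep'⟩
  rw [Finset.card_insert_of_notMem hxs, hcard] at hle
  omega

/-- On the ball of radius 2, approximation by the net gives `2‖T‖ ≤ t + ‖T‖`, hence `‖T‖ ≤ t`. -/
theorem norm_apply_le_of_net {F G : Type*} [NormedAddCommGroup F] [NormedSpace ℝ F]
    [FiniteDimensional ℝ F] [NormedAddCommGroup G] [NormedSpace ℝ G] {s : Finset F}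
    (hs : ∀ x : F, ‖x‖ ≤ 2 → ∃ c ∈ s, ‖x - c‖ ≤ 1) (T : F →ₗ[ℝ] G) {t : ℝ} (ht : 0 ≤ t)
    (hT : ∀ c ∈ s, ‖T c‖ ≤ t) (x : F) : ‖T x‖ ≤ t * ‖x‖ := by
  set L := T.toContinuousLinearMap
  have hball (y : F) (hy : ‖y‖ ≤ 2) : ‖L y‖ ≤ t + ‖L‖ := by
    obtain ⟨c, hc, hyc⟩ := hs y hy
    calc ‖L y‖ = ‖L c + L (y - c)‖ := by rw [← map_add, add_sub_cancel]
      _ ≤ ‖L c‖ + ‖L (y - c)‖ := norm_add_le _ _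
      _ ≤ t + ‖L‖ * 1 := add_le_add (hT c hc)
          ((L.le_opNorm _).trans (mul_le_mul_of_nonneg_left hyc (norm_nonneg _)))
      _ = t + ‖L‖ := by rw [mul_one]
  have hL : ‖L‖ ≤ (t + ‖L‖) / 2 := by
    refine L.opNorm_le_bound (by positivity) fun y => ?_
    rcases eq_or_ne y 0 with rfl | hy
    · simp
    have hy0 : 0 < ‖y‖ := norm_pos_iff.2 hy
    have h := hball ((2 / ‖y‖) • y) (by
      rw [norm_smul, Real.norm_of_nonneg (by positivity), div_mul_cancel₀ _ hy0.ne'])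
    rw [map_smul, norm_smul, Real.norm_of_nonneg (by positivity)] at h
    have := mul_le_mul_of_nonneg_right h hy0.le
    rw [mul_right_comm, div_mul_cancel₀ _ hy0.ne'] at this
    linarith
  exact (L.le_opNorm x).trans (by gcongr; linarith)

theorem inner_toEuclideanLin_le_rhoMax {m : ℕ} {A : Matrix (Fin m) (Fin m) ℝ}
    (hA : A.IsHermitian) (v : EuclideanSpace ℝ (Fin m)) :
    inner ℝ v (Matrix.toEuclideanLin A v) ≤ rhoMax A * ‖v‖ ^ 2 := by
  rw [inner_toEuclideanLin_self_eq_sum hA, ← hA.eigenvectorBasis.sum_sq_inner_right,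
    Finset.mul_sum]
  exact Finset.sum_le_sum fun i _ =>
    mul_le_mul_of_nonneg_right (eigenvalues_le_rhoMax hA i) (sq_nonneg _)

/-- With probability at least `1 - δ`, the squared operator norm of a Gaussian matrix with
independent `N(0, γ² A)` columns is at most a multiple of `γ² max (K ρ(A)) (Tr A)`. -/
theorem GaussianIIDColumns.measure_opNorm_gt_le {Ω : Type*} [MeasurableSpace Ω] {P : Measure Ω}
    [IsProbabilityMeasure P] {n K : ℕ} (hK : 1 ≤ K) {E : Ω → Matrix (Fin n) (Fin K) ℝ} {γ : ℝ}
    {A : Matrix (Fin n) (Fin n) ℝ} (hA : A.PosSemidef) (hE : GaussianIIDColumns P E γ A)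
    {δ : ℝ} (hδ : 0 < δ) (hδ1 : δ < 1) :
    P {ω | ¬ ∀ v, ‖Matrix.toEuclideanLin (E ω) v‖ ≤
      √(γ ^ 2 * (8 + 16 * (Real.log 5 + Real.log δ⁻¹)) * max (K * rhoMax A) A.trace) * ‖v‖}
      ≤ ENNReal.ofReal δ := by
  obtain ⟨s, hcard, hs2, hnet⟩ := exists_finset_net (EuclideanSpace ℝ (Fin K))
  rw [finrank_euclideanSpace_fin] at hcard
  -- Chosen so that `exp (-u) = 5⁻ᴷ δ`, which pays for the union bound.
  set u : ℝ := K * Real.log 5 + Real.log δ⁻¹ with hu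
  set M := max (K * rhoMax A) A.trace with hM
  set B := γ ^ 2 * (8 + 16 * (Real.log 5 + Real.log δ⁻¹)) * M with hB
  have hρ := rhoMax_nonneg hA
  have hK' : (1 : ℝ) ≤ K := by exact_mod_cast hK
  have hlog : 0 ≤ Real.log δ⁻¹ := Real.log_nonneg ((one_le_inv₀ hδ).2 hδ1.le)
  have hlog5 : 0 ≤ Real.log 5 := Real.log_nonneg (by norm_num)
  have hu0 : 0 ≤ u := by positivity
  have htr : 0 ≤ A.trace := hA.trace_nonneg
  have hpt (c : EuclideanSpace ℝ (Fin K)) (hc : c ∈ s) :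
      P {ω | B < ‖Matrix.toEuclideanLin (E ω) c‖ ^ 2} ≤ ENNReal.ofReal (Real.exp (-u)) := by
    have hc4 : ‖c‖ ^ 2 ≤ 4 := by nlinarith [hs2 c hc, norm_nonneg c]
    have htail := measure_norm_sq_gt_le ((hA.smul (sq_nonneg γ)).smul (sq_nonneg ‖c‖))
      (hE.hasLaw_toEuclideanLin hA c) (r := ‖c‖ ^ 2 * (γ ^ 2 * rhoMax A))
      (by positivity) (fun v => by
        have := inner_toEuclideanLin_le_rhoMax hA.1 v
        simp only [map_smul, LinearMap.smul_apply, real_inner_smul_right]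
        rw [mul_assoc, mul_assoc]
        gcongr) u
    refine (measure_mono fun ω (hω : B < _) => ?_).trans htail
    refine lt_of_le_of_lt ?_ hω
    simp only [Matrix.trace_smul, smul_eq_mul]
    have h1 : rhoMax A * u ≤ M * (Real.log 5 + Real.log δ⁻¹) := by
      have ha : K * rhoMax A ≤ M := le_max_left _ _
      have hb : rhoMax A ≤ M := by nlinarith
      nlinarith
    have h2 : A.trace ≤ M := le_max_right _ _
    -- Net points have `‖c‖² ≤ 4`, which turns `2 + 4 * (…)` into the constant `8 + 16 * (…)`.
    calc 2 * (‖c‖ ^ 2 * (γ ^ 2 * A.trace)) + 4 * (‖c‖ ^ 2 * (γ ^ 2 * rhoMax A)) * u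
        = ‖c‖ ^ 2 * (γ ^ 2 * (2 * A.trace + 4 * (rhoMax A * u))) := by ring
      _ ≤ 4 * (γ ^ 2 * (2 * M + 4 * (M * (Real.log 5 + Real.log δ⁻¹)))) := by gcongr
      _ = B := by rw [hB]; ring
  calc _ ≤ P (⋃ c ∈ s, {ω | B < ‖Matrix.toEuclideanLin (E ω) c‖ ^ 2}) := by
        refine measure_mono fun ω hω => ?_
        by_contra hcon
        simp only [Set.mem_iUnion, not_exists, Set.mem_ofPred_eq, not_lt] at hcon
        exact hω fun v => norm_apply_le_of_net hnet _ (Real.sqrt_nonneg _)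
          (fun c hc => Real.le_sqrt_of_sq_le (hcon c hc)) v
    _ ≤ ∑ c ∈ s, P {ω | B < ‖Matrix.toEuclideanLin (E ω) c‖ ^ 2} := measure_biUnion_finset_le _ _
    _ ≤ ∑ _c ∈ s, ENNReal.ofReal (Real.exp (-u)) := Finset.sum_le_sum hpt
    _ = ENNReal.ofReal (s.card * Real.exp (-u)) := by
        rw [Finset.sum_const, nsmul_eq_mul, ENNReal.ofReal_mul (by positivity),
          ENNReal.ofReal_natCast]
    _ ≤ ENNReal.ofReal δ := by
        refine ENNReal.ofReal_le_ofReal ?_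
        have hexp : Real.exp (-u) = (5 ^ K)⁻¹ * δ := by
          rw [hu, neg_add, Real.exp_add, Real.exp_neg, Real.exp_nat_mul,
            Real.exp_log (by norm_num), Real.log_inv, neg_neg, Real.exp_log hδ]
        have hc5 : (s.card : ℝ) ≤ 5 ^ K := by exact_mod_cast hcard
        rw [hexp, ← mul_assoc]
        refine mul_le_of_le_one_left hδ.le ?_
        rw [← div_eq_mul_inv]
        exact div_le_one_of_le₀ hc5 (by positivity)

/-! ### The two bounds -/

theorem mainTheorem7 (δ : ℝ) (hδ : δ ∈ Set.Ioo (0 : ℝ) 1) :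
    ∃ d : ℝ, 0 < d ∧ ∃ D : ℝ, 0 < D ∧
      ∀ (n K : ℕ) (H : Matrix (Fin n) (Fin K) ℝ) (γ : ℝ) (A : Matrix (Fin n) (Fin n) ℝ)
        (Ω : Type*) [MeasurableSpace Ω] (P : Measure Ω) [IsProbabilityMeasure P]
        (E : Ω → Matrix (Fin n) (Fin K) ℝ),
        1 ≤ K → H.rank = K → A.PosSemidef → GaussianIIDColumns P E γ A →
        d * n * γ ^ 2 * rhoMax A < 1 / 4 * rhoMin (H.transpose * H) →
        ENNReal.ofReal (1 - δ) ≤ P {ω |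
          1 / (n : ℝ) * ‖colProj H - colProj (H + E ω)‖ ^ 2
              ≤ γ ^ 2 * D * condNumber (H.transpose * H) ^ 2 *
                max (max (K * rhoMax A) A.trace / (n * rhoMin (H.transpose * H)))
                  (condNumber (H.transpose * H) * (rhoMax A / n) *
                    (H.transpose * H)⁻¹.trace) ∧
          1 / (n : ℝ) * ‖colProj (H + E ω) - colProj H‖ ^ 2
              ≤ γ ^ 2 * D * condNumber (H.transpose * H) ^ 3 *
                max (K / n * (rhoMax A / rhoMin (H.transpose * H)))
                  (A.trace / (n * rhoMin (H.transpose * H)))} := by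
  have hlog : 0 ≤ Real.log δ⁻¹ := Real.log_nonneg ((one_le_inv₀ hδ.1).2 hδ.2.le)
  have hlog5 : 0 ≤ Real.log 5 := Real.log_nonneg (by norm_num)
  -- The factor 16 is the square of the 4 in `norm_colProj_sub_le`.
  refine ⟨1, one_pos, 16 * (8 + 16 * (Real.log 5 + Real.log δ⁻¹)), by positivity, ?_⟩
  intro n K H γ A Ω _ P _ E hK hH hA hE _
  set C := 8 + 16 * (Real.log 5 + Real.log δ⁻¹)
  set M := max (K * rhoMax A) A.trace with hM
  set ρ := rhoMin (H.transpose * H)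
  set κ := condNumber (H.transpose * H)
  have hC : 0 ≤ C := by positivity
  have hM0 : 0 ≤ M := le_max_of_le_right hA.trace_nonneg
  have hρ : 0 < ρ := rhoMin_transpose_mul_self_pos hK hH
  have hκ : 1 ≤ κ := (one_le_div hρ).2 (rhoMin_le_rhoMax hK (by
    simpa using Matrix.isHermitian_conjTranspose_mul_self H))
  have hn : 0 < (n : ℝ) := by
    have : K ≤ n := hH ▸ (Matrix.rank_le_card_height H).trans_eq (Fintype.card_fin n)
    exact_mod_cast hK.trans this
  set S := {ω | ∀ v, ‖Matrix.toEuclideanLin (E ω) v‖ ≤ √(γ ^ 2 * C * M) * ‖v‖} with hS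
  have hSc : P Sᶜ ≤ ENNReal.ofReal δ := hE.measure_opNorm_gt_le hK hA hδ.1 hδ.2
  have hS1 : ENNReal.ofReal (1 - δ) ≤ P S := by
    -- Subadditivity is enough here, so measurability of `S` is not needed.
    have h1 : 1 ≤ P S + P Sᶜ := by
      rw [← measure_univ (μ := P), ← Set.union_compl_self S]
      exact measure_union_le _ _
    rw [ENNReal.ofReal_sub _ hδ.1.le, ENNReal.ofReal_one]
    exact tsub_le_iff_right.2 (h1.trans (by gcongr))
  refine hS1.trans (measure_mono fun ω hω => ?_)
  have hproj := norm_colProj_sub_le H (E ω) (Real.sqrt_pos.2 hρ) (Real.sqrt_nonneg _) (fun v => by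
    refine le_of_sq_le_sq ?_ (norm_nonneg _)
    rw [mul_pow, Real.sq_sqrt hρ.le]
    exact rhoMin_mul_norm_sq_le H v) hω
  have hbase : 1 / (n : ℝ) * ‖colProj H - colProj (H + E ω)‖ ^ 2 ≤
      γ ^ 2 * (16 * C) * (M / (n * ρ)) := by
    calc 1 / (n : ℝ) * ‖colProj H - colProj (H + E ω)‖ ^ 2
        ≤ 1 / (n : ℝ) * (4 * (√(γ ^ 2 * C * M) / √ρ)) ^ 2 := by gcongr
      _ = _ := by
        rw [mul_pow, div_pow, Real.sq_sqrt (by positivity), Real.sq_sqrt hρ.le]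
        field_simp
        ring
  constructor
  · refine hbase.trans ?_
    exact mul_le_mul (le_mul_of_one_le_right (by positivity) (one_le_pow₀ hκ))
      (le_max_left _ _) (by positivity) (by positivity)
  · rw [norm_sub_rev]
    refine hbase.trans ?_
    -- The second maximum is exactly `M / (n * ρ)`, whereas in the first bound this is only the left
    -- argument.
    have hmax : max (K / n * (rhoMax A / ρ)) (A.trace / (n * ρ)) = M / (n * ρ) := by
      rw [hM, ← max_div_div_right (by positivity), div_mul_div_comm]
    rw [hmax]
    exact mul_le_mul_of_nonneg_right
      (le_mul_of_one_le_right (by positivity) (one_le_pow₀ hκ)) (by positivity)
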